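/- An overpartition of a non-negative integer $n$ is a non-increasing sequence of positive integers with sum $n$ in which the first occurrence of each number may be overlined. For an overpartition $\pi$, let $\overline{\mathrm{mex}}(\pi)$ be the smallest positive integer that does not occur among the non-overlined parts of $\pi$, and let $$\sigma\overline{\mathrm{mex}}(n)=\sum_{\pi}\overline{\mathrm{mex}}(\pi),$$ where $\pi$ runs over all overpartitions of $n$. Then $$\sigma\overline{\mathrm{mex}}(n)\sim\frac{e^{\pi\sqrt{n}}}{8\,n^{3/4}}\qquad\text{as } n\to\infty,$$ where on the right-hand side $\pi$ is the usual circle constant. -/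

import Mathlib

/-- An overpartition of `n`: a partition of `n` (a non-increasing sequence of positive integers
with sum `n`) in which the first occurrence of each number may be overlined. It is given by the
underlying partition and the set of those part sizes whose first occurrence is overlined. -/
@[ext]
structure Overpartition (n : ℕ) where
  /-- the underlying partition, overlines forgotten -/
  partition : n.Partition
  /-- the part sizes whose first occurrence is overlined -/
  overlined : Finset ℕ
  /-- only numbers that occur as parts can be overlined -/
  overlined_subset : overlined ⊆ partition.parts.toFinset

namespace Overpartition

/-- Overpartitions as pairs of a partition and a subset of its set of part sizes. -/
def equivSigma (n : ℕ) :
    (Σ p : n.Partition, {s : Finset ℕ // s ∈ p.parts.toFinset.powerset}) ≃ Overpartition n where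
  toFun x := ⟨x.1, x.2.1, Finset.mem_powerset.1 x.2.2⟩
  invFun π := ⟨π.partition, π.overlined, Finset.mem_powerset.2 π.overlined_subset⟩
  left_inv _ := rfl
  right_inv _ := rfl

/-- There are finitely many overpartitions of `n`. -/
instance (n : ℕ) : Fintype (Overpartition n) := Fintype.ofEquiv _ (equivSigma n)

/-- The multiset of non-overlined parts: one copy of each overlined number is removed. -/
def nonOverlinedParts {n : ℕ} (π : Overpartition n) : Multiset ℕ :=
  π.partition.parts - π.overlined.val

/-- The minimal excludant of an overpartition: the smallest positive integer that does not occur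
among the non-overlined parts. -/
noncomputable def mex {n : ℕ} (π : Overpartition n) : ℕ :=
  sInf {m : ℕ | 0 < m ∧ m ∉ π.nonOverlinedParts}

/-- The set in the definition of `mex` is nonempty, so that `mex` is its least element. -/
theorem isLeast_mex {n : ℕ} (π : Overpartition n) :
    IsLeast {m : ℕ | 0 < m ∧ m ∉ π.nonOverlinedParts} π.mex := by
  have h : {m : ℕ | 0 < m ∧ m ∉ π.nonOverlinedParts}.Nonempty := by
    refine ⟨n + 1, Nat.succ_pos n, fun hm => ?_⟩
    have h1 : n + 1 ∈ π.partition.parts := Multiset.mem_of_le (Multiset.sub_le_self _ _) hm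
    have h2 := π.partition.le_of_mem_parts h1
    omega
  exact ⟨Nat.sInf_mem h, fun m hm => Nat.sInf_le hm⟩

end Overpartition

/-- The sum of the minimal excludants of all overpartitions of `n`. For `n = 0` the empty
overpartition, of minimal excludant `1`, gives the value `1`. -/
noncomputable def sigmaMexOver (n : ℕ) : ℕ := ∑ π : Overpartition n, π.mex

/-! An overpartition has minimal excludant above m exactly when its non-overlined parts contain 1,
…, m; removing one copy of each leaves an arbitrary overpartition (`Overpartition.ltMexEquiv`).
Summing over m, the generating function is ∑ q^(m(m+1)/2) times ∏ (1 + q^i)/(1 - q^i). Gauss's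
identity and Euler's ∏ (1 + q^i) = ∏ (1 - q^(2i-1))⁻¹ collapse this to D(q)^3 with D(q) = ∏ (1 +
q^i) (`sigmaMexOver_eq_coeff`). The identities are proved modulo q^M, from a finite form of Gauss's.

The asymptotics come from a saddle point on a circle. Up to a power of q, D is η(2τ)/η(τ), so
D(e^(-s)) D(e^(-2π²/s)) √2 = exp(s/24 + π²/(12s)) (`prodOneAddPow_exp_mul`). Hence near the saddle
D(e^(-s))^3 e^(ns) is about 2^(-3/2) exp(ns + π²/(4s)); the saddle is s = π/(2√n) = x², and the
relevant angles have size x³. After rescaling, the integrand tends to a Gaussian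
(`tendsto_saddleIntegrand`) and is dominated on the whole circle by a multiple of 1/(1 + u²)
(`norm_saddleIntegrand_le`), so no separate minor-arc estimate is needed. -/

/-! ### Gauss's triangular number identity modulo a power of q. -/

open Finset in
/-- A finite form of Gauss's identity for the sum of `q` to the triangular numbers (Shanks). -/
theorem prod_one_sub_odd_mul_sum_triangular {R : Type*} [CommRing R] (q : R) (n : ℕ) :
    (∏ j ∈ range n, (1 - q ^ (2 * j + 1))) * ∑ s ∈ range (2 * n), q ^ (s * (s + 1) / 2) =
      ∑ s ∈ range n, (∏ j ∈ range s, (1 - q ^ (2 * j + 1))) *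
        (∏ j ∈ Ico s n, (1 - q ^ (2 * (j + 1)))) * q ^ (s * (2 * n + 1)) := by
  induction n with
  | zero => simp
  | succ n ih =>
    have e1 : 2 * n * (2 * n + 1) / 2 = n * (2 * n + 1) := by
      rw [mul_assoc]; exact Nat.mul_div_cancel_left _ two_pos
    have e2 : (2 * n + 1) * (2 * n + 1 + 1) / 2 = (n + 1) * (2 * n + 1) := by
      rw [show (2 * n + 1) * (2 * n + 1 + 1) = 2 * ((n + 1) * (2 * n + 1)) by ring]
      exact Nat.mul_div_cancel_left _ two_pos
    -- `U` is a telescoping certificate for passing from n to n + 1. The factor 1 - q^(2s) makes `U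
    -- 0` vanish, and `U n` with the new term s = n supplies the two new triangular powers.
    set U : ℕ → R := fun s => (∏ j ∈ range s, (1 - q ^ (2 * j + 1))) *
      (∏ j ∈ Ico s n, (1 - q ^ (2 * (j + 1)))) * (1 - q ^ (2 * s)) * q ^ (s * (2 * n + 1)) with hU
    have key : ∀ s ∈ range n,
        (∏ j ∈ range s, (1 - q ^ (2 * j + 1))) *
          (∏ j ∈ Ico s (n + 1), (1 - q ^ (2 * (j + 1)))) * q ^ (s * (2 * (n + 1) + 1)) =
        (1 - q ^ (2 * n + 1)) * ((∏ j ∈ range s, (1 - q ^ (2 * j + 1))) *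
          (∏ j ∈ Ico s n, (1 - q ^ (2 * (j + 1)))) * q ^ (s * (2 * n + 1))) +
        (U (s + 1) - U s) := by
      intro s hs
      have hs : s < n := mem_range.1 hs
      simp only [hU]
      rw [prod_Ico_succ_top hs.le, prod_eq_prod_Ico_succ_bot hs, prod_range_succ]
      ring
    rw [sum_range_succ _ n, sum_congr rfl key, sum_add_distrib, ← mul_sum, ← ih, sum_range_sub,
      show 2 * (n + 1) = 2 * n + 1 + 1 by ring, sum_range_succ, sum_range_succ, e1, e2,
      prod_range_succ]
    simp only [hU, Ico_self, prod_empty, prod_Ico_succ_top le_rfl]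
    ring

open Finset in
/-- Gauss's identity modulo a power of `q`. -/
theorem prod_one_sub_odd_mul_sum_triangular_of_pow_eq_zero {R : Type*} [CommRing R] {q : R} {M : ℕ}
    (hM : 0 < M) (hq : q ^ M = 0) :
    (∏ j ∈ range M, (1 - q ^ (2 * j + 1))) * ∑ s ∈ range (2 * M), q ^ (s * (s + 1) / 2) =
      ∏ j ∈ range M, (1 - q ^ (2 * (j + 1))) := by
  -- The terms with s ≥ 1 carry q^(s(2M+1)), which is zero.
  rw [prod_one_sub_odd_mul_sum_triangular, sum_eq_single 0]
  · simp
  · intro s _ hs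
    rw [pow_eq_zero_of_le (m := M) _ hq, mul_zero]
    have : 1 ≤ s := Nat.one_le_iff_ne_zero.2 hs
    nlinarith
  · intro h
    simp [hM.ne'] at h

open Finset in
theorem isUnit_prod_one_sub_pow_of_pow_eq_zero {R : Type*} [CommRing R] {q : R} {M : ℕ}
    (hq : q ^ M = 0) (s : Finset ℕ) (f : ℕ → ℕ) (hf : ∀ i ∈ s, f i ≠ 0) :
    IsUnit (∏ i ∈ s, (1 - q ^ f i)) := by
  have hn : IsNilpotent q := ⟨M, hq⟩
  induction s using Finset.induction_on with
  | empty => simp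
  | insert a s ha ih =>
    rw [prod_insert ha]
    refine IsUnit.mul ?_ (ih fun i hi => hf i (mem_insert_of_mem hi))
    exact (hn.pow_of_pos (hf a (mem_insert_self _ _))).isUnit_one_sub

open Finset in
/-- If `q ^ M = 0` and `G` is the quotient `∏ (1 + q ^ i) / ∏ (1 - q ^ i)`, then the product of `G`
with the sum of `q` to the triangular numbers is the cube of `∏ (1 + q ^ i)`. -/
theorem sum_triangular_mul_eq_prod_one_add_cube {R : Type*} [CommRing R] {q G : R} {M : ℕ}
    (hM : 0 < M) (hq : q ^ M = 0)
    (hG : G * ∏ i ∈ range M, (1 - q ^ (i + 1)) = ∏ i ∈ range M, (1 + q ^ (i + 1))) :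
    (∑ s ∈ range (2 * M), q ^ (s * (s + 1) / 2)) * G =
      (∏ i ∈ range M, (1 + q ^ (i + 1))) ^ 3 := by
  have hT := prod_one_sub_odd_mul_sum_triangular_of_pow_eq_zero hM hq
  set T := ∑ s ∈ range (2 * M), q ^ (s * (s + 1) / 2)
  set a := ∏ i ∈ range M, (1 - q ^ (i + 1)) with ha
  set b := ∏ i ∈ range M, (1 + q ^ (i + 1)) with hb
  set o := ∏ j ∈ range M, (1 - q ^ (2 * j + 1)) with ho
  set e := ∏ j ∈ range M, (1 - q ^ (2 * (j + 1))) with he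
  have hea : e = a * b := by
    rw [ha, hb, he, ← prod_mul_distrib]
    exact prod_congr rfl fun i _ => by ring
  have hoe : o * e = a := by
    have h1 : o * e = ∏ i ∈ range (2 * M), (1 - q ^ (i + 1)) := by
      rw [ho, he, ← prod_mul_distrib]
      generalize M = K
      induction K with
      | zero => simp
      | succ k ih =>
        rw [prod_range_succ, ih, show 2 * (k + 1) = 2 * k + 1 + 1 by ring, prod_range_succ,
          prod_range_succ, mul_assoc]
    rw [h1, two_mul, prod_range_add, ha]
    refine (congrArg _ (prod_eq_one fun i _ => ?_)).trans (mul_one _)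
    rw [pow_eq_zero_of_le (by omega) hq, sub_zero]
  have ua : IsUnit a := isUnit_prod_one_sub_pow_of_pow_eq_zero hq _ _ fun i _ => i.succ_ne_zero
  have uo : IsUnit o := isUnit_prod_one_sub_pow_of_pow_eq_zero hq _ _ fun i _ => (2 * i).succ_ne_zero
  -- Euler's identity. With it, T o = e = a b gives T = a b², and G a = b then gives T G = b³.
  have hob : o * b = 1 := by
    refine ua.mul_left_cancel ?_
    rw [mul_one]; nth_rw 2 [← hoe]; rw [hea]; ring
  refine ua.mul_left_cancel (uo.mul_left_cancel ?_)
  linear_combination (T * o) * hG + b * hT + b * hea - a * b ^ 2 * hob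

/-! ### Counting overpartitions by minimal excludant. -/

namespace Overpartition

theorem card_eq_sum_pow (n : ℕ) :
    Fintype.card (Overpartition n) = ∑ p : n.Partition, 2 ^ p.parts.toFinset.card := by
  rw [← Fintype.card_congr (equivSigma n), Fintype.card_sigma]
  refine Finset.sum_congr rfl fun p _ => ?_
  rw [Fintype.card_coe, Finset.card_powerset]

theorem lt_mex_iff {n : ℕ} (π : Overpartition n) (m : ℕ) :
    m < π.mex ↔ (Finset.Icc 1 m).val ≤ π.nonOverlinedParts := by
  rw [Multiset.le_iff_subset (Finset.nodup _)]
  constructor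
  · intro h j hj
    have hj : 1 ≤ j ∧ j ≤ m := by simpa using hj
    by_contra hn
    have := π.isLeast_mex.2 ⟨hj.1, hn⟩
    omega
  · intro h
    by_contra! hn
    obtain ⟨h1, h2⟩ := π.isLeast_mex.1
    exact h2 (h (by simpa using ⟨Nat.succ_le_of_lt h1, hn⟩))

theorem mex_le {n : ℕ} (π : Overpartition n) : π.mex ≤ n + 1 := by
  refine π.isLeast_mex.2 ⟨n.succ_pos, fun hm => ?_⟩
  have h1 : n + 1 ∈ π.partition.parts := Multiset.mem_of_le (Multiset.sub_le_self _ _) hm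
  have h2 := π.partition.le_of_mem_parts h1
  omega

theorem sum_Icc_val (m : ℕ) : (Finset.Icc 1 m).val.sum = m * (m + 1) / 2 := by
  have h : (Finset.Icc 1 m).val.sum = ∑ i ∈ Finset.Icc 1 m, i := by
    rw [← Finset.sum_map_val, Multiset.map_id']
  have h2 := Finset.sum_range_id (m + 1)
  rw [Finset.range_eq_Ico, Finset.sum_eq_sum_Ico_succ_bot (Nat.succ_pos m), zero_add, zero_add] at h2
  rw [h, mul_comm m]
  exact h2

theorem overlined_val_le {n : ℕ} (π : Overpartition n) : π.overlined.val ≤ π.partition.parts :=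
  (Multiset.le_iff_subset (Finset.nodup _)).2 fun _ hj =>
    Multiset.mem_toFinset.1 (π.overlined_subset hj)

theorem overlined_val_add {n : ℕ} {m : ℕ} (π : Overpartition n) (h : m < π.mex) :
    π.overlined.val + (Finset.Icc 1 m).val ≤ π.partition.parts := by
  rw [lt_mex_iff, nonOverlinedParts] at h
  exact (add_le_add_right h _).trans_eq (add_tsub_cancel_of_le π.overlined_val_le)

/-- Overpartitions with minimal excludant greater than `m` are overpartitions with one more
non-overlined copy of each of `1, …, m`. -/
def ltMexEquiv (k m : ℕ) :
    {π : Overpartition (k + m * (m + 1) / 2) // m < π.mex} ≃ Overpartition k where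
  toFun x :=
    { partition :=
        { parts := x.1.partition.parts - (Finset.Icc 1 m).val
          parts_pos := fun hi =>
            x.1.partition.parts_pos (Multiset.mem_of_le (Multiset.sub_le_self _ _) hi)
          parts_sum := by
            have h := congrArg Multiset.sum (tsub_add_cancel_of_le
              ((Multiset.le_add_left _ _).trans (x.1.overlined_val_add x.2)))
            rw [Multiset.sum_add, x.1.partition.parts_sum, sum_Icc_val] at h
            omega }
      overlined := x.1.overlined
      overlined_subset := fun j hj => Multiset.mem_toFinset.2 <|
        Multiset.mem_of_le (le_tsub_of_add_le_right (x.1.overlined_val_add x.2)) hj }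
  invFun π := ⟨
    { partition :=
        { parts := π.partition.parts + (Finset.Icc 1 m).val
          parts_pos := fun hi => by
            rcases Multiset.mem_add.1 hi with hi | hi
            · exact π.partition.parts_pos hi
            · exact (Finset.mem_Icc.1 (Finset.mem_def.2 hi)).1
          parts_sum := by rw [Multiset.sum_add, π.partition.parts_sum, sum_Icc_val] }
      overlined := π.overlined
      overlined_subset := fun j hj => by
        rw [Multiset.toFinset_add]
        exact Finset.mem_union_left _ (π.overlined_subset hj) }, by
    rw [lt_mex_iff, nonOverlinedParts]
    exact le_tsub_of_add_le_left (add_le_add_left π.overlined_val_le _)⟩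
  left_inv x := by
    refine Subtype.ext (Overpartition.ext (Nat.Partition.ext ?_) rfl)
    exact tsub_add_cancel_of_le ((Multiset.le_add_left _ _).trans (x.1.overlined_val_add x.2))
  right_inv π := Overpartition.ext (Nat.Partition.ext (add_tsub_cancel_right _ _)) rfl

theorem card_lt_mex (n m : ℕ) :
    (Finset.univ.filter fun π : Overpartition n => m < π.mex).card =
      if m * (m + 1) / 2 ≤ n then Fintype.card (Overpartition (n - m * (m + 1) / 2)) else 0 := by
  split_ifs with h
  · obtain ⟨k, rfl⟩ := Nat.exists_eq_add_of_le' h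
    rw [Nat.add_sub_cancel, ← Fintype.card_congr (ltMexEquiv k m), Fintype.card_subtype]
  · rw [Finset.card_eq_zero, Finset.filter_eq_empty_iff]
    intro π _ hm
    obtain ⟨c, hc⟩ := Multiset.le_iff_exists_add.1
      ((Multiset.le_add_left _ _).trans (π.overlined_val_add hm))
    have := congrArg Multiset.sum hc
    rw [Multiset.sum_add, π.partition.parts_sum, sum_Icc_val] at this
    omega

end Overpartition

/-- A minimal excludant is the number of m ≥ 0 below it; exchange the two sums. Since it is at most
n + 1, any cutoff beyond n loses nothing. -/
theorem sigmaMexOver_eq_sum (n L : ℕ) (hL : n < L) :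
    sigmaMexOver n = ∑ m ∈ Finset.range L,
      if m * (m + 1) / 2 ≤ n then Fintype.card (Overpartition (n - m * (m + 1) / 2)) else 0 := by
  simp_rw [← Overpartition.card_lt_mex, Finset.card_filter]
  rw [Finset.sum_comm, sigmaMexOver]
  refine Finset.sum_congr rfl fun π _ => ?_
  rw [← Finset.card_filter]
  have : (Finset.range L).filter (fun m => m < π.mex) = Finset.range π.mex := by
    ext m
    have := π.mex_le
    simp only [Finset.mem_filter, Finset.mem_range]
    omega
  rw [this, Finset.card_range]

/-! ### Generating functions. -/

open PowerSeries PowerSeries.WithPiTopology in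
/-- If `g i ≡ 1` modulo `X ^ (i + 1)`, the low coefficients of the product `∏ g i` are those of its
partial products. -/
theorem PowerSeries.X_pow_dvd_sub_prod_of_hasProd {R : Type*} [CommRing R] [TopologicalSpace R]
    [T2Space R] {g : ℕ → R⟦X⟧} {G : R⟦X⟧} (h : HasProd g G)
    (hg : ∀ i, X ^ (i + 1) ∣ g i - 1) (M : ℕ) :
    X ^ M ∣ G - ∏ i ∈ Finset.range M, g i := by
  have hd : ∀ k, X ^ M ∣ ∏ i ∈ Finset.range (M + k), g i - ∏ i ∈ Finset.range M, g i := by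
    intro k
    induction k with
    | zero => simp
    | succ k ih =>
      rw [← add_assoc, Finset.prod_range_succ]
      have h1 : (X : R⟦X⟧) ^ M ∣ g (M + k) - 1 :=
        (pow_dvd_pow _ (by omega)).trans (hg (M + k))
      have := dvd_add (h1.mul_left (∏ i ∈ Finset.range (M + k), g i)) ih
      convert this using 1
      ring
  rw [X_pow_dvd_iff]
  intro m hm
  have ht := (tendsto_iff_coeff_tendsto R _ _ _).1 h.tendsto_prod_nat m
  have he : Filter.Tendsto (fun k => coeff m (∏ i ∈ Finset.range k, g i)) Filter.atTop
      (nhds (coeff m (∏ i ∈ Finset.range M, g i))) := by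
    refine tendsto_const_nhds.congr' ?_
    filter_upwards [Filter.eventually_ge_atTop M] with k hk
    obtain ⟨j, rfl⟩ := Nat.exists_eq_add_of_le hk
    have := X_pow_dvd_iff.1 (hd j) m hm
    rw [map_sub, sub_eq_zero] at this
    exact this.symm
  rw [map_sub, sub_eq_zero]
  exact tendsto_nhds_unique ht he

open PowerSeries PowerSeries.WithPiTopology in
-- Each part size that occurs has weight 2, overlined or not, so size i contributes 1 + 2 ∑ X^(ij) =
-- (1 + X^i)/(1 - X^i). The truncated form is what the quotient by X^M requires.
theorem Overpartition.X_pow_dvd_genFun_mul_prod_sub (M : ℕ) :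
    (X : ℤ⟦X⟧) ^ M ∣ (PowerSeries.mk fun n => (Fintype.card (Overpartition n) : ℤ)) *
      ∏ i ∈ Finset.range M, (1 - X ^ (i + 1)) - ∏ i ∈ Finset.range M, (1 + X ^ (i + 1)) := by
  set G : ℤ⟦X⟧ := PowerSeries.mk fun n => (Fintype.card (Overpartition n) : ℤ) with hG
  have hGf : G = Nat.Partition.genFun fun _ _ => (2 : ℤ) := by
    ext n
    rw [hG, coeff_mk, Nat.Partition.coeff_genFun, Overpartition.card_eq_sum_pow]
    push_cast
    refine Finset.sum_congr rfl fun p _ => ?_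
    simp [Finsupp.prod]
  have h : HasProd (fun i : ℕ => 1 + ∑' j : ℕ, 2 * (X : ℤ⟦X⟧) ^ ((i + 1) * (j + 1))) G := by
    rw [hGf]
    convert! Nat.Partition.hasProd_genFun (R := ℤ) fun _ _ => (2 : ℤ) using 5
    rw [smul_eq_C_mul, map_ofNat]
  have hterm : ∀ i : ℕ, (1 + ∑' j, 2 * (X : ℤ⟦X⟧) ^ ((i + 1) * (j + 1))) * (1 - X ^ (i + 1)) =
      1 + X ^ (i + 1) := by
    intro i
    have h0 : ((X : ℤ⟦X⟧) ^ (i + 1)).constantCoeff = 0 := by simp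
    have hs := summable_pow_of_constantCoeff_eq_zero h0
    have e : ∑' j, 2 * (X : ℤ⟦X⟧) ^ ((i + 1) * (j + 1)) =
        2 * (X ^ (i + 1) * ∑' j, ((X : ℤ⟦X⟧) ^ (i + 1)) ^ j) := by
      rw [← hs.tsum_mul_left, ← (hs.mul_left _).tsum_mul_left]
      refine tsum_congr fun j => ?_
      rw [pow_mul, pow_succ']
    have e2 := tsum_pow_mul_one_sub_of_constantCoeff_eq_zero h0
    rw [e]
    linear_combination (2 * X ^ (i + 1)) * e2
  have hdvd := PowerSeries.X_pow_dvd_sub_prod_of_hasProd h (fun i => by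
    have hu : IsUnit ((1 : ℤ⟦X⟧) - X ^ (i + 1)) := by
      rw [isUnit_iff_constantCoeff]; simp
    rw [← hu.dvd_mul_right, sub_mul, hterm]
    exact ⟨2, by ring⟩) M
  have := hdvd.mul_right (∏ i ∈ Finset.range M, (1 - X ^ (i + 1)))
  rwa [sub_mul, ← Finset.prod_mul_distrib, Finset.prod_congr rfl fun i _ => hterm i] at this

open PowerSeries in
/-- The sums of minimal excludants are the coefficients of `∏ (1 + X ^ i) ^ 3`. -/
theorem sigmaMexOver_eq_coeff {n M : ℕ} (h : n < M) :
    (sigmaMexOver n : ℤ) = coeff n ((∏ i ∈ Finset.range M, (1 + (X : ℤ⟦X⟧) ^ (i + 1))) ^ 3) := by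
  set G : ℤ⟦X⟧ := PowerSeries.mk fun n => (Fintype.card (Overpartition n) : ℤ) with hG
  have hS : (sigmaMexOver n : ℤ) =
      coeff n ((∑ s ∈ Finset.range (2 * M), (X : ℤ⟦X⟧) ^ (s * (s + 1) / 2)) * G) := by
    rw [Finset.sum_mul, map_sum, sigmaMexOver_eq_sum n (2 * M) (by omega)]
    push_cast
    refine Finset.sum_congr rfl fun m _ => ?_
    rw [coeff_X_pow_mul', hG, coeff_mk]
  rw [hS, ← sub_eq_zero, ← map_sub]
  refine X_pow_dvd_iff.1 ?_ n h
  -- In the quotient by X^M the image of X is nilpotent, so the finite identities apply.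
  set I := Ideal.span {(X : ℤ⟦X⟧) ^ M}
  rw [← Ideal.mem_span_singleton, ← Ideal.Quotient.eq]
  have hq : (Ideal.Quotient.mk I X) ^ M = 0 := by
    rw [← map_pow, Ideal.Quotient.eq_zero_iff_mem]
    exact Ideal.mem_span_singleton_self _
  have := Overpartition.X_pow_dvd_genFun_mul_prod_sub M
  rw [← hG, ← Ideal.mem_span_singleton, ← Ideal.Quotient.eq] at this
  simp only [map_mul, map_prod, map_sub, map_add, map_one, map_pow, map_sum] at this ⊢
  exact sum_triangular_mul_eq_prod_one_add_cube (by omega) hq this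

/-! ### The infinite product and its modular transformation. -/

/-- The product `∏ (1 + q ^ k)` over the positive integers `k`, the generating function of the
partitions into distinct parts. -/
noncomputable def prodOneAddPow (q : ℂ) : ℂ := ∏' k : ℕ, (1 + q ^ (k + 1))

theorem summable_norm_pow_succ {q : ℂ} (hq : ‖q‖ < 1) : Summable fun k : ℕ => ‖q ^ (k + 1)‖ := by
  simpa using (summable_nat_add_iff 1).mpr (summable_geometric_of_lt_one (norm_nonneg _) hq)

theorem hasProd_prodOneAddPow {q : ℂ} (hq : ‖q‖ < 1) :
    HasProd (fun k : ℕ => 1 + q ^ (k + 1)) (prodOneAddPow q) :=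
  (multipliable_one_add_of_summable (summable_norm_pow_succ hq)).hasProd

open Filter Topology in
theorem tendsto_prod_prodOneAddPow {q : ℂ} (hq : ‖q‖ < 1) :
    Tendsto (fun N => ∏ k ∈ Finset.range N, (1 + q ^ (k + 1))) atTop (𝓝 (prodOneAddPow q)) :=
  (hasProd_prodOneAddPow hq).tendsto_prod_nat

theorem sum_norm_pow_succ_le {q : ℂ} (hq : ‖q‖ < 1) (N : ℕ) :
    ∑ k ∈ Finset.range N, ‖q ^ (k + 1)‖ ≤ ‖q‖ / (1 - ‖q‖) := by
  refine ((summable_norm_pow_succ hq).sum_le_tsum _ fun _ _ => norm_nonneg _).trans_eq ?_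
  simp_rw [norm_pow, pow_succ']
  rw [tsum_mul_left, tsum_geometric_of_lt_one (norm_nonneg _) hq, div_eq_mul_inv]

theorem norm_prod_one_add_pow_le {q : ℂ} (hq : ‖q‖ < 1) (N : ℕ) :
    ‖∏ k ∈ Finset.range N, (1 + q ^ (k + 1))‖ ≤ Real.exp (‖q‖ / (1 - ‖q‖)) := by
  rw [norm_prod]
  refine (Finset.prod_le_prod (fun _ _ => norm_nonneg _) fun k _ => ?_).trans
    ((Real.exp_sum _ _).symm.trans_le (Real.exp_le_exp.2 (sum_norm_pow_succ_le hq N)))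
  refine (norm_add_le _ _).trans ?_
  rw [norm_one, add_comm]
  exact Real.add_one_le_exp _

theorem norm_prodOneAddPow_sub_one_le {q : ℂ} (hq : ‖q‖ < 1) :
    ‖prodOneAddPow q - 1‖ ≤ Real.exp (‖q‖ / (1 - ‖q‖)) - 1 := by
  refine le_of_tendsto ((tendsto_prod_prodOneAddPow hq).sub_const 1).norm
    (Filter.Eventually.of_forall fun N => ?_)
  refine (Finset.norm_prod_one_add_sub_one_le _ _).trans ?_
  gcongr
  exact sum_norm_pow_succ_le hq N

open Filter Topology in
theorem tendsto_prodOneAddPow_zero : Tendsto prodOneAddPow (𝓝 0) (𝓝 1) := by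
  rw [tendsto_iff_norm_sub_tendsto_zero]
  have h : Tendsto (fun q : ℂ => Real.exp (‖q‖ / (1 - ‖q‖)) - 1) (𝓝 0) (𝓝 0) := by
    have : ContinuousAt (fun q : ℂ => Real.exp (‖q‖ / (1 - ‖q‖)) - 1) 0 := by
      refine ((continuous_norm.continuousAt.div (by fun_prop) (by simp)).rexp).sub
        continuousAt_const
    simpa [ContinuousAt] using this
  refine squeeze_zero' (Eventually.of_forall fun _ => norm_nonneg _) ?_ h
  filter_upwards [Metric.ball_mem_nhds (0 : ℂ) one_pos] with q hq
  exact norm_prodOneAddPow_sub_one_le (by simpa using hq)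

/-- Factorwise difference of squares; this is what relates the product to η(2τ)/η(τ). -/
theorem prodOneAddPow_mul_tprod {q : ℂ} (hq : ‖q‖ < 1) :
    prodOneAddPow q * ∏' k : ℕ, (1 - q ^ (k + 1)) = ∏' k : ℕ, (1 - (q ^ 2) ^ (k + 1)) := by
  rw [prodOneAddPow, ← (hasProd_prodOneAddPow hq).multipliable.tprod_mul
    (ModularForm.multipliable_one_sub_pow hq)]
  exact tprod_congr fun k => by ring

theorem tprod_one_sub_pow_ne_zero {q : ℂ} (hq : ‖q‖ < 1) : ∏' k : ℕ, (1 - q ^ (k + 1)) ≠ 0 := by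
  simp_rw [sub_eq_add_neg]
  refine tprod_one_add_ne_zero_of_summable (fun k h => ?_) (by simpa using summable_norm_pow_succ hq)
  have h1 : q ^ (k + 1) = 1 := by linear_combination -h
  have h2 : ‖q‖ ^ (k + 1) < 1 := pow_lt_one₀ (norm_nonneg _) hq k.succ_ne_zero
  rw [← norm_pow, h1, norm_one] at h2
  exact lt_irrefl _ h2

theorem norm_exp_neg_lt_one {s : ℂ} (hs : 0 < s.re) : ‖Complex.exp (-s)‖ < 1 := by
  rw [Complex.norm_exp]
  simpa using hs

theorem eta_I_mul_div_two_pi (s : ℂ) :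
    ModularForm.eta (Complex.I * s / (2 * Real.pi)) =
      Complex.exp (-s / 24) * ∏' k : ℕ, (1 - Complex.exp (-s) ^ (k + 1)) := by
  have hpi : (Real.pi : ℂ) ≠ 0 := by exact_mod_cast Real.pi_ne_zero
  have h : 2 * Real.pi * Complex.I * (Complex.I * s / (2 * Real.pi)) = -s := by
    field_simp
    linear_combination s * Complex.I_sq
  simp only [ModularForm.eta, ModularForm.eta_q, Function.Periodic.qParam, h]
  simp

/-- With τ = is/(2π), the inversion τ ↦ -1/τ becomes s ↦ 4π²/s on the right half-plane. -/
theorem eta_I_mul_div_two_pi_inv {s : ℂ} (hs : 0 < s.re) :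
    ModularForm.eta (Complex.I * (4 * Real.pi ^ 2 / s) / (2 * Real.pi)) =
      (Complex.sqrt Complex.I)⁻¹ * (Complex.sqrt (Complex.I * s / (2 * Real.pi)) *
        ModularForm.eta (Complex.I * s / (2 * Real.pi))) := by
  have hpi : (Real.pi : ℂ) ≠ 0 := by exact_mod_cast Real.pi_ne_zero
  have hs0 : s ≠ 0 := fun h => by simp [h] at hs
  have hz : Complex.I * s / (2 * Real.pi) ∈ UpperHalfPlane.upperHalfPlaneSet := by
    have : Complex.I * s / (2 * Real.pi) = ((2 * Real.pi)⁻¹ : ℝ) * (Complex.I * s) := by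
      push_cast; field_simp
    change 0 < (Complex.I * s / (2 * Real.pi)).im
    rw [this, Complex.im_ofReal_mul, Complex.I_mul_im]
    positivity
  have h := ModularForm.eta_comp_eq_csqrt_I_inv hz
  simp only [Function.comp_apply, Pi.smul_apply, Pi.mul_apply, smul_eq_mul] at h
  rw [← h]
  congr 1
  field_simp
  linear_combination 4 * Complex.I_sq

/-- The modular transformation of `∏ (1 + q ^ k)`. -/
theorem prodOneAddPow_exp_mul {s : ℂ} (hs : 0 < s.re) :
    prodOneAddPow (Complex.exp (-s)) * prodOneAddPow (Complex.exp (-(2 * Real.pi ^ 2 / s))) * √2 =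
      Complex.exp (s / 24 + Real.pi ^ 2 / (12 * s)) := by
  have hpi : (Real.pi : ℂ) ≠ 0 := by exact_mod_cast Real.pi_ne_zero
  have hs0 : s ≠ 0 := fun h => by simp [h] at hs
  set w : ℂ := 2 * Real.pi ^ 2 / s with hw
  have hw0 : 0 < w.re := by
    have : w = ((2 * Real.pi ^ 2 : ℝ) : ℂ) * s⁻¹ := by rw [hw]; push_cast; field_simp
    rw [this, Complex.re_ofReal_mul, Complex.inv_re]
    have := Complex.normSq_pos.2 hs0
    positivity
  set h : ℂ → ℂ := fun s => ModularForm.eta (Complex.I * s / (2 * Real.pi)) with hh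
  have key : ∀ s : ℂ, 0 < s.re → h s ≠ 0 ∧
      prodOneAddPow (Complex.exp (-s)) * h s = Complex.exp (s / 24) * h (2 * s) := by
    intro s hs
    have hq := norm_exp_neg_lt_one hs
    simp only [hh, eta_I_mul_div_two_pi]
    refine ⟨mul_ne_zero (Complex.exp_ne_zero _) (tprod_one_sub_pow_ne_zero hq), ?_⟩
    have := prodOneAddPow_mul_tprod hq
    rw [← Complex.exp_nat_mul, show ((2 : ℕ) : ℂ) * -s = -(2 * s) by push_cast; ring] at this
    rw [← this, ← mul_assoc (Complex.exp (s / 24)), ← Complex.exp_add,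
      show s / 24 + -(2 * s) / 24 = -s / 24 by ring]
    ring
  have h2s : 0 < (2 * s).re := by simpa using hs
  have e1 := (key s hs).2
  have e2 := (key w hw0).2
  -- Inversion sends s to 2w and 2s to w, so the quotient at w is the inverse of the quotient at s
  -- up to elementary factors.
  have f1 : h (2 * w) = (Complex.sqrt Complex.I)⁻¹ *
      (Complex.sqrt (Complex.I * s / (2 * Real.pi)) * h s) := by
    rw [← eta_I_mul_div_two_pi_inv hs]
    simp only [hh, hw]; congr 1; ring
  have f2 : h w = (Complex.sqrt Complex.I)⁻¹ *
      (Complex.sqrt (Complex.I * (2 * s) / (2 * Real.pi)) * h (2 * s)) := by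
    rw [← eta_I_mul_div_two_pi_inv h2s]
    simp only [hh, hw]; congr 1; field_simp; norm_num
  have hz : Complex.I * s / (2 * Real.pi) ≠ 0 :=
    div_ne_zero (mul_ne_zero Complex.I_ne_zero hs0) (mul_ne_zero two_ne_zero hpi)
  -- Source of the factor √2; scaling by a positive real does not change the branch.
  have hsq : Complex.sqrt (Complex.I * (2 * s) / (2 * Real.pi)) =
      √2 * Complex.sqrt (Complex.I * s / (2 * Real.pi)) := by
    rw [show Complex.I * (2 * s) / (2 * Real.pi) = ((2 : ℝ) : ℂ) * (Complex.I * s / (2 * Real.pi)) by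
      push_cast; ring]
    simp only [Complex.sqrt]
    rw [Complex.cpow_def_of_ne_zero (mul_ne_zero (by norm_num) hz), Complex.cpow_def_of_ne_zero hz,
      Complex.log_ofReal_mul two_pos hz, add_mul, Complex.exp_add, Real.sqrt_eq_rpow,
      Real.rpow_def_of_pos two_pos]
    push_cast
    norm_num
  have hI : Complex.sqrt Complex.I ≠ 0 := by simp [Complex.sqrt]
  have hzz : Complex.sqrt (Complex.I * s / (2 * Real.pi)) ≠ 0 := by
    simp only [Complex.sqrt]
    rw [Complex.cpow_def_of_ne_zero hz]
    exact Complex.exp_ne_zero _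
  have hs1 := (key s hs).1
  have hs2 := (key (2 * s) h2s).1
  rw [f1, f2, hsq] at e2
  rw [Complex.exp_add, show (Real.pi : ℂ) ^ 2 / (12 * s) = w / 24 by rw [hw]; field_simp; norm_num]
  have e2' : prodOneAddPow (Complex.exp (-w)) * √2 * h (2 * s) = Complex.exp (w / 24) * h s := by
    refine mul_left_cancel₀ (mul_ne_zero (inv_ne_zero hI) hzz) ?_
    linear_combination e2
  refine mul_right_cancel₀ (mul_ne_zero hs1 hs2) ?_
  linear_combination prodOneAddPow (Complex.exp (-w)) * √2 * h (2 * s) * e1 +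
    Complex.exp (s / 24) * h (2 * s) * e2'

/-! ### Decay away from the positive real axis. -/

/-- The squared norm is (1 + x)² - 2x(1 - cos φ). As (1 + x)² ≤ 4, its ratio to (1 + x)² is at most
1 - y/2 ≤ exp(-y/2) with y = x(1 - cos φ); the square root gives the 1/4. -/
theorem norm_one_add_ofReal_mul_exp_le {x : ℝ} (hx0 : 0 ≤ x) (hx1 : x ≤ 1) (φ : ℝ) :
    ‖1 + (x : ℂ) * Complex.exp (φ * Complex.I)‖ ≤
      (1 + x) * Real.exp (-(x * (1 - Real.cos φ)) / 4) := by
  have hc := Real.cos_le_one φ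
  refine abs_le_of_sq_le_sq' ?_ (by positivity) |>.2
  have h1 : ‖1 + (x : ℂ) * Complex.exp (φ * Complex.I)‖ ^ 2 =
      (1 + x) ^ 2 - 2 * (x * (1 - Real.cos φ)) := by
    rw [Complex.sq_norm, Complex.exp_mul_I, Complex.normSq_apply]
    simp [Complex.cos_ofReal_re, Complex.sin_ofReal_re]
    nlinarith [Real.sin_sq_add_cos_sq φ]
  rw [h1, mul_pow, ← Real.exp_nat_mul]
  have h2 := Real.add_one_le_exp (((2 : ℕ) : ℝ) * (-(x * (1 - Real.cos φ)) / 4))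
  push_cast at h2 ⊢
  have hy : 0 ≤ x * (1 - Real.cos φ) := mul_nonneg hx0 (by linarith)
  have h4 : (1 + x) ^ 2 ≤ 4 := by nlinarith
  nlinarith [mul_le_mul_of_nonneg_left h2 (sq_nonneg (1 + x)), mul_le_mul_of_nonneg_right h4 hy]

/-- Sum of the series `∑ r ^ k * (1 - cos (k * θ))`. -/
theorem hasSum_pow_mul_one_sub_cos {r : ℝ} (hr0 : 0 ≤ r) (hr1 : r < 1) (θ : ℝ) :
    HasSum (fun k : ℕ => r ^ k * (1 - Real.cos (k * θ)))
      (r * (1 - Real.cos θ) * (1 + r) /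
        ((1 - r) * ((1 - r) ^ 2 + 2 * r * (1 - Real.cos θ)))) := by
  have hc := Real.cos_le_one θ
  have h1 := hasSum_geometric_of_lt_one hr0 hr1
  set z : ℂ := r * Complex.exp (θ * Complex.I) with hz
  have hnorm : ‖z‖ < 1 := by
    rw [hz, norm_mul, Complex.norm_exp_ofReal_mul_I, mul_one, Complex.norm_real, Real.norm_eq_abs,
      abs_of_nonneg hr0]
    exact hr1
  have h2 := Complex.hasSum_re (hasSum_geometric_of_norm_lt_one hnorm)
  have h3 := h1.sub h2
  have e : ∀ k : ℕ, (z ^ k).re = r ^ k * Real.cos (k * θ) := by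
    intro k
    rw [hz, mul_pow, ← Complex.exp_nat_mul, ← Complex.ofReal_pow, Complex.re_ofReal_mul,
      show (k : ℂ) * (θ * Complex.I) = ((k * θ : ℝ) : ℂ) * Complex.I by push_cast; ring,
      Complex.exp_ofReal_mul_I_re]
  have hd : 0 < 1 - r := by linarith
  have hpos : 0 < (1 - r) ^ 2 + 2 * r * (1 - Real.cos θ) :=
    add_pos_of_pos_of_nonneg (by positivity) (mul_nonneg (by positivity) (by linarith))
  have hns : Complex.normSq (1 - z) = (1 - r) ^ 2 + 2 * r * (1 - Real.cos θ) := by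
    rw [hz, Complex.exp_mul_I, Complex.normSq_apply]
    simp [Complex.cos_ofReal_re, Complex.sin_ofReal_re]
    nlinarith [Real.sin_sq_add_cos_sq θ]
  have hre : (1 - z).re = 1 - r * Real.cos θ := by
    have := e 1
    simp only [pow_one, Nat.cast_one, one_mul] at this
    rw [Complex.sub_re, this, Complex.one_re]
  rw [Complex.inv_re, hns, hre] at h3
  have hv : r * (1 - Real.cos θ) * (1 + r) /
      ((1 - r) * ((1 - r) ^ 2 + 2 * r * (1 - Real.cos θ))) =
      (1 - r)⁻¹ - (1 - r * Real.cos θ) / ((1 - r) ^ 2 + 2 * r * (1 - Real.cos θ)) := by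
    rw [eq_sub_iff_add_eq, div_add_div _ _ (mul_pos hd hpos).ne' hpos.ne', inv_eq_one_div,
      div_eq_div_iff (mul_pos (mul_pos hd hpos) hpos).ne' hd.ne']
    ring
  have hf : (fun k : ℕ => r ^ k * (1 - Real.cos (k * θ))) = fun k => r ^ k - (z ^ k).re :=
    funext fun k => by rw [e, mul_sub, mul_one]
  rw [hv, hf]
  exact h3

open Filter Topology in
/-- On a circle, `∏ (1 + q ^ k)` is largest at the positive real point. -/
theorem norm_prodOneAddPow_le {r : ℝ} (hr0 : 0 ≤ r) (hr1 : r < 1) (θ : ℝ) :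
    ‖prodOneAddPow (r * Complex.exp (θ * Complex.I))‖ ≤ ‖prodOneAddPow r‖ *
      Real.exp (-(r * (1 - Real.cos θ) * (1 + r) /
        ((1 - r) * ((1 - r) ^ 2 + 2 * r * (1 - Real.cos θ)))) / 4) := by
  have hnr : ‖(r : ℂ)‖ < 1 := by
    rwa [Complex.norm_real, Real.norm_eq_abs, abs_of_nonneg hr0]
  have hnorm : ‖(r : ℂ) * Complex.exp (θ * Complex.I)‖ < 1 := by
    rwa [norm_mul, Complex.norm_exp_ofReal_mul_I, mul_one]
  -- The cosine series starts at k = 0 with a zero term; the shift aligns it with the product, which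
  -- starts at exponent 1.
  have hs := (hasSum_pow_mul_one_sub_cos hr0 hr1 θ).tendsto_sum_nat.comp (tendsto_add_atTop_nat 1)
  refine le_of_tendsto_of_tendsto' (tendsto_prod_prodOneAddPow hnorm).norm
    ((tendsto_prod_prodOneAddPow hnr).norm.mul
      ((Real.continuous_exp.tendsto _).comp (hs.neg.div_const 4))) fun N => ?_
  simp only [Function.comp_apply]
  rw [Finset.sum_range_succ', norm_prod, norm_prod]
  simp only [pow_zero, Nat.cast_zero, zero_mul, Real.cos_zero, sub_self, mul_zero, add_zero]
  rw [← Finset.sum_neg_distrib, Finset.sum_div, Real.exp_sum, ← Finset.prod_mul_distrib]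
  refine Finset.prod_le_prod (fun _ _ => norm_nonneg _) fun k _ => ?_
  have := norm_one_add_ofReal_mul_exp_le (pow_nonneg hr0 (k + 1))
    (pow_le_one₀ hr0 hr1.le) (((k + 1 : ℕ) : ℝ) * θ)
  have e1 : ((r : ℂ) * Complex.exp (θ * Complex.I)) ^ (k + 1) =
      ((r ^ (k + 1) : ℝ) : ℂ) * Complex.exp (((((k + 1 : ℕ) : ℝ) * θ : ℝ) : ℂ) * Complex.I) := by
    rw [mul_pow, ← Complex.exp_nat_mul]
    push_cast
    ring_nf
  have e2 : ‖1 + (r : ℂ) ^ (k + 1)‖ = 1 + r ^ (k + 1) := by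
    rw [← Complex.ofReal_pow, ← Complex.ofReal_one, ← Complex.ofReal_add, Complex.norm_real,
      Real.norm_eq_abs, abs_of_nonneg (by positivity)]
  rw [e1, e2]
  exact this

open Filter Topology in
theorem one_le_norm_prodOneAddPow {r : ℝ} (hr0 : 0 ≤ r) (hr1 : r < 1) :
    1 ≤ ‖prodOneAddPow r‖ := by
  have hnr : ‖(r : ℂ)‖ < 1 := by
    rwa [Complex.norm_real, Real.norm_eq_abs, abs_of_nonneg hr0]
  refine ge_of_tendsto' (tendsto_prod_prodOneAddPow hnr).norm fun N => ?_
  rw [norm_prod]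
  refine (Finset.prod_const_one (s := Finset.range N)).symm.trans_le
    (Finset.prod_le_prod (fun _ _ => zero_le_one) fun k _ => ?_)
  rw [← Complex.ofReal_pow, ← Complex.ofReal_one, ← Complex.ofReal_add, Complex.norm_real,
    Real.norm_eq_abs, abs_of_nonneg (by positivity)]
  have := pow_nonneg hr0 (k + 1)
  linarith

/-! ### Cauchy's coefficient integral. -/

theorem sigmaMexOver_eq_polynomial_coeff {n M : ℕ} (h : n < M) :
    (sigmaMexOver n : ℂ) =
      ((∏ i ∈ Finset.range M, (1 + (Polynomial.X : Polynomial ℂ) ^ (i + 1))) ^ 3).coeff n := by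
  have h1 := sigmaMexOver_eq_coeff h
  have h2 : (∏ i ∈ Finset.range M, (1 + (PowerSeries.X : PowerSeries ℤ) ^ (i + 1))) ^ 3 =
      Polynomial.coeToPowerSeries.ringHom
        ((∏ i ∈ Finset.range M, (1 + (Polynomial.X : Polynomial ℤ) ^ (i + 1))) ^ 3) := by
    rw [map_pow, map_prod]
    simp
  rw [h2, Polynomial.coeToPowerSeries.ringHom_apply, Polynomial.coeff_coe] at h1
  have h3 := congrArg (Int.cast : ℤ → ℂ) h1
  rw [← eq_intCast (Int.castRingHom ℂ) (Polynomial.coeff _ _), ← Polynomial.coeff_map] at h3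
  simpa [Polynomial.map_prod] using h3

open Complex in
theorem integral_exp_int_mul_I (m : ℤ) (hm : m ≠ 0) :
    ∫ θ in (-Real.pi)..Real.pi, exp (m * I * θ) = 0 := by
  rw [integral_exp_mul_complex (mul_ne_zero (by exact_mod_cast hm) I_ne_zero)]
  have : exp (m * I * (Real.pi : ℂ)) = exp (m * I * ((-Real.pi : ℝ) : ℂ)) := by
    rw [exp_eq_exp_iff_exists_int]
    exact ⟨m, by push_cast; ring⟩
  rw [this, sub_self, zero_div]

open Complex in
/-- Cauchy's coefficient formula for polynomials on the circle of radius `exp (-t)`. -/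
theorem Polynomial.integral_eval_exp_mul_exp (p : Polynomial ℂ) (n : ℕ) (t : ℝ) :
    ∫ θ in (-Real.pi)..Real.pi, p.eval (exp (-(t - θ * I))) * exp (n * (t - θ * I)) =
      2 * Real.pi * p.coeff n := by
  set N := max (p.natDegree + 1) (n + 1)
  have e : ∀ θ : ℝ, p.eval (exp (-(t - θ * I))) * exp (n * (t - θ * I)) =
      ∑ k ∈ Finset.range N, p.coeff k * exp ((n - k) * t) * exp (((k - n : ℤ) : ℂ) * I * θ) := by
    intro θ
    rw [Polynomial.eval_eq_sum_range' (n := N) (by simp [N]), Finset.sum_mul]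
    refine Finset.sum_congr rfl fun k _ => ?_
    rw [← exp_nat_mul, mul_assoc, mul_assoc, ← exp_add, ← exp_add]
    congr 2
    push_cast
    ring
  simp_rw [e]
  rw [intervalIntegral.integral_finsetSum fun k _ =>
    (Continuous.intervalIntegrable (by fun_prop) _ _)]
  rw [Finset.sum_eq_single n]
  · simp only [sub_self, zero_mul, exp_zero, mul_one, Int.cast_zero,
      intervalIntegral.integral_const, real_smul, ofReal_sub, ofReal_neg]
    ring
  · intro k _ hk
    rw [intervalIntegral.integral_const_mul, integral_exp_int_mul_I _ (by omega), mul_zero]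
  · intro h
    exact absurd (Finset.mem_range.2 (by simp [N])) h

open Complex Filter Topology in
/-- The integral representation of the sum of minimal excludants. -/
theorem integral_prodOneAddPow_cube (n : ℕ) {t : ℝ} (ht : 0 < t) :
    ∫ θ in (-Real.pi)..Real.pi, prodOneAddPow (exp (-(t - θ * I))) ^ 3 * exp (n * (t - θ * I)) =
      2 * Real.pi * sigmaMexOver n := by
  have hq : ∀ θ : ℝ, ‖exp (-((t : ℂ) - θ * I))‖ < 1 := fun θ =>
    norm_exp_neg_lt_one (by simpa using ht)
  have hqn : ∀ θ : ℝ, ‖exp (-((t : ℂ) - θ * I))‖ = Real.exp (-t) := fun θ => by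
    rw [norm_exp]; simp
  set F : ℕ → ℝ → ℂ := fun M θ =>
    (∏ k ∈ Finset.range M, (1 + exp (-(t - θ * I)) ^ (k + 1))) ^ 3 * exp (n * (t - θ * I)) with hF
  have hlim : Tendsto (fun M => ∫ θ in (-Real.pi)..Real.pi, F M θ) atTop
      (𝓝 (∫ θ in (-Real.pi)..Real.pi,
        prodOneAddPow (exp (-(t - θ * I))) ^ 3 * exp (n * (t - θ * I)))) := by
    refine intervalIntegral.tendsto_integral_filter_of_dominated_convergence
      (fun _ => Real.exp (Real.exp (-t) / (1 - Real.exp (-t))) ^ 3 * Real.exp (n * t)) ?_ ?_ ?_ ?_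
    · exact Eventually.of_forall fun M => Continuous.aestronglyMeasurable (by fun_prop)
    · refine Eventually.of_forall fun M => MeasureTheory.ae_of_all _ fun θ _ => ?_
      have h1 := norm_prod_one_add_pow_le (hq θ) M
      rw [hqn] at h1
      rw [hF, norm_mul, norm_pow, norm_exp (n * _)]
      gcongr
      simp
    · exact intervalIntegrable_const
    · exact MeasureTheory.ae_of_all _ fun θ _ =>
        ((tendsto_prod_prodOneAddPow (hq θ)).pow 3).mul_const _
  -- The truncated integrals are constant once M > n, so their limit is that constant.
  refine tendsto_nhds_unique hlim (tendsto_const_nhds.congr' ?_)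
  filter_upwards [eventually_gt_atTop n] with M hM
  rw [sigmaMexOver_eq_polynomial_coeff hM, ← Polynomial.integral_eval_exp_mul_exp _ _ t]
  simp [hF, Polynomial.eval_prod]

/-! ### Saddle point analysis by dominated convergence. -/

/-- The integrand of the coefficient integral of `∏ (1 + q ^ k) ^ 3` near the saddle point `x ^ 2`,
with rescaled variable and divided by its main exponential term. -/
noncomputable def saddleIntegrand (x u : ℝ) : ℂ :=
  √2 ^ 3 * prodOneAddPow (Complex.exp (-(x ^ 2 - (x ^ 3 * u : ℝ) * Complex.I))) ^ 3 *
    Complex.exp (-(Real.pi ^ 2 / (4 * x ^ 2)) * (1 + u * x * Complex.I))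

open Complex in
theorem re_sq_sub_mul_I (x y : ℝ) : ((x : ℂ) ^ 2 - y * I).re = x ^ 2 := by
  rw [← ofReal_pow, sub_re, re_ofReal_mul, I_re, mul_zero, sub_zero, ofReal_re]

theorem one_sub_mul_I_ne_zero (u x : ℝ) : (1 - u * x * Complex.I : ℂ) ≠ 0 := fun h => by
  have := congrArg Complex.re h
  simp at this

open Complex in
-- Apply the modular transformation at s = x²p, p = 1 - iux. The singular exponents combine through
-- 1/p - (2 - p) = (1 - p)²/p, where (1 - p)² = -u²x² cancels the pole in x.
theorem saddleIntegrand_eq {x : ℝ} (hx : 0 < x) (u : ℝ) :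
    saddleIntegrand x u =
      exp ((x ^ 2 - (x ^ 3 * u : ℝ) * I) / 8 - Real.pi ^ 2 / 4 * u ^ 2 / (1 - u * x * I)) /
        prodOneAddPow (exp (-(2 * Real.pi ^ 2 / (x ^ 2 - (x ^ 3 * u : ℝ) * I)))) ^ 3 := by
  set s : ℂ := x ^ 2 - (x ^ 3 * u : ℝ) * I with hs
  have hre : 0 < s.re := by
    rw [hs, re_sq_sub_mul_I]
    positivity
  have h := prodOneAddPow_exp_mul hre
  set d := prodOneAddPow (exp (-(2 * Real.pi ^ 2 / s)))
  have hd : d ≠ 0 := fun h0 => exp_ne_zero _ (by rw [← h, h0]; ring)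
  rw [eq_div_iff (pow_ne_zero 3 hd), saddleIntegrand, ← hs]
  have h3 : √2 ^ 3 * prodOneAddPow (exp (-s)) ^ 3 * d ^ 3 =
      exp (3 * (s / 24 + Real.pi ^ 2 / (12 * s))) := by
    rw [show (3 : ℂ) = ((3 : ℕ) : ℂ) by norm_num, exp_nat_mul, ← h]
    ring
  rw [mul_right_comm, h3, ← exp_add]
  congr 1
  have hx0 : (x : ℂ) ≠ 0 := by exact_mod_cast hx.ne'
  have hsx : s = x ^ 2 * (1 - u * x * I) := by rw [hs]; push_cast; ring
  have hp := one_sub_mul_I_ne_zero u x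
  have h1 : (1 + u * x * I : ℂ) = 2 - (1 - u * x * I) := by ring
  have h2 : (u : ℂ) ^ 2 = -(1 - (1 - u * x * I)) ^ 2 / x ^ 2 := by
    rw [eq_div_iff (pow_ne_zero 2 hx0)]
    linear_combination (u ^ 2 * x ^ 2 : ℂ) * I_sq
  rw [hsx, h1, h2]
  generalize (1 - u * x * I : ℂ) = p at hp
  field_simp
  ring

open Complex Filter Topology in
-- For fixed u the dual argument exp(-2π²/s) tends to 0, because the real part of 2π²/s is 2π²/(x²(1
-- + u²x²)); the denominator thus tends to 1.
theorem tendsto_saddleIntegrand (u : ℝ) :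
    Tendsto (fun x => saddleIntegrand x u) (𝓝[>] 0)
      (𝓝 ((Real.exp (-(Real.pi ^ 2 / 4) * u ^ 2) : ℝ) : ℂ)) := by
  have h1 : Tendsto (fun x : ℝ => exp (((x : ℂ) ^ 2 - (x ^ 3 * u : ℝ) * I) / 8 -
      Real.pi ^ 2 / 4 * u ^ 2 / (1 - u * x * I))) (𝓝[>] 0)
      (𝓝 ((Real.exp (-(Real.pi ^ 2 / 4) * u ^ 2) : ℝ) : ℂ)) := by
    have hc : ContinuousAt (fun x : ℝ => exp (((x : ℂ) ^ 2 - (x ^ 3 * u : ℝ) * I) / 8 -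
        Real.pi ^ 2 / 4 * u ^ 2 / (1 - u * x * I))) 0 := by
      refine ContinuousAt.cexp (ContinuousAt.sub (by fun_prop) ?_)
      exact ContinuousAt.div (by fun_prop) (by fun_prop) (by simp)
    have := hc.tendsto.mono_left (nhdsWithin_le_nhds (s := Set.Ioi 0))
    convert this using 2
    simp
  have h2 : Tendsto (fun x : ℝ => exp (-(2 * Real.pi ^ 2 / ((x : ℂ) ^ 2 - (x ^ 3 * u : ℝ) * I))))
      (𝓝[>] 0) (𝓝 0) := by
    rw [tendsto_exp_nhds_zero_iff]
    have e : ∀ x : ℝ, (-(2 * Real.pi ^ 2 / ((x : ℂ) ^ 2 - (x ^ 3 * u : ℝ) * I))).re =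
        -((2 * Real.pi ^ 2 / (1 + (u * x) ^ 2)) * (x ^ 2)⁻¹) := by
      intro x
      rcases eq_or_ne x 0 with rfl | hx
      · simp
      have hx0 : (x : ℂ) ≠ 0 := by exact_mod_cast hx
      have hp := one_sub_mul_I_ne_zero u x
      have hp' : (1 + (u * x : ℝ) * I : ℂ) ≠ 0 := by
        simpa using one_sub_mul_I_ne_zero (-u) x
      have hpp : (1 + (u * x : ℂ) ^ 2) = (1 - u * x * I) * (1 + (u * x : ℝ) * I) := by
        push_cast
        linear_combination (u ^ 2 * x ^ 2 : ℂ) * I_sq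
      have hs : (x : ℂ) ^ 2 - (x ^ 3 * u : ℝ) * I = x ^ 2 * (1 - u * x * I) := by push_cast; ring
      have : -(2 * Real.pi ^ 2 / ((x : ℂ) ^ 2 - (x ^ 3 * u : ℝ) * I)) =
          ((-((2 * Real.pi ^ 2 / (1 + (u * x) ^ 2)) * (x ^ 2)⁻¹) : ℝ) : ℂ) *
            (1 + (u * x : ℝ) * I) := by
        rw [hs]
        simp only [ofReal_neg, ofReal_mul, ofReal_div, ofReal_add, ofReal_one, ofReal_pow,
          ofReal_inv, ofReal_ofNat] at hpp hp' ⊢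
        rw [hpp]
        generalize (1 - u * x * I : ℂ) = p at hp
        generalize (1 + u * x * I : ℂ) = p' at hp'
        field_simp
      rw [this, re_ofReal_mul]
      simp
    simp_rw [e]
    refine tendsto_neg_atTop_atBot.comp (Tendsto.pos_mul_atTop (C := 2 * Real.pi ^ 2)
      (by positivity) ?_ ?_)
    · have hc : ContinuousAt (fun x : ℝ => 2 * Real.pi ^ 2 / (1 + (u * x) ^ 2)) 0 :=
        ContinuousAt.div (by fun_prop) (by fun_prop) (by simp)
      have := hc.tendsto.mono_left (nhdsWithin_le_nhds (s := Set.Ioi 0))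
      simpa using this
    · refine tendsto_inv_nhdsGT_zero.comp (tendsto_nhdsWithin_iff.2 ⟨?_, ?_⟩)
      · have : ContinuousAt (fun x : ℝ => x ^ 2) 0 := by fun_prop
        simpa using this.tendsto.mono_left (nhdsWithin_le_nhds (s := Set.Ioi 0))
      · filter_upwards [self_mem_nhdsWithin] with x hx
        exact pow_pos (Set.mem_Ioi.1 hx) 2
  have h3 := (tendsto_prodOneAddPow_zero.comp h2).pow 3
  have h4 := h1.div h3 (by simp)
  rw [one_pow, div_one] at h4
  refine h4.congr' ?_
  filter_upwards [self_mem_nhdsWithin] with x hx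
  exact (saddleIntegrand_eq hx u).symm

open Complex in
-- On the real axis the dual factor in the modular transformation is at least 1 and can be dropped.
theorem norm_prodOneAddPow_exp_neg_le {t : ℝ} (ht : 0 < t) :
    ‖prodOneAddPow (Real.exp (-t) : ℝ)‖ * √2 ≤ Real.exp (t / 24 + Real.pi ^ 2 / (12 * t)) := by
  have h := congrArg norm (prodOneAddPow_exp_mul (s := t) (by simpa using ht))
  have e1 : exp (-(t : ℂ)) = (Real.exp (-t) : ℝ) := by push_cast; rfl
  have e2 : exp (-(2 * (Real.pi : ℂ) ^ 2 / t)) = (Real.exp (-(2 * Real.pi ^ 2 / t)) : ℝ) := by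
    push_cast; rfl
  have e3 : exp ((t : ℂ) / 24 + Real.pi ^ 2 / (12 * t)) =
      (Real.exp (t / 24 + Real.pi ^ 2 / (12 * t)) : ℝ) := by push_cast; rfl
  rw [e1, e2, e3, norm_mul, norm_mul, norm_real, norm_real, Real.norm_of_nonneg (Real.exp_pos _).le,
    Real.norm_of_nonneg (Real.sqrt_nonneg 2)] at h
  rw [← h]
  have h1 : 1 ≤ ‖prodOneAddPow (Real.exp (-(2 * Real.pi ^ 2 / t)) : ℝ)‖ :=
    one_le_norm_prodOneAddPow (Real.exp_pos _).le (Real.exp_lt_one_iff.2 (by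
      have : 0 < 2 * Real.pi ^ 2 / t := by positivity
      linarith))
  gcongr
  exact le_mul_of_one_le_right (norm_nonneg _) h1

/-- The decay on the circle of radius `exp (-x ^ 2)` at the angle `x ^ 3 * u`. -/
theorem le_geometric_cos_sum {x u : ℝ} (hx : 0 < x) (hx1 : x ^ 2 ≤ 1 / 2) (hu : |x ^ 3 * u| ≤ Real.pi) :
    (1 / Real.pi ^ 2 * u ^ 2) / (1 + 2 / Real.pi ^ 2 * u ^ 2 * x ^ 2) ≤
      Real.exp (-x ^ 2) * (1 - Real.cos (x ^ 3 * u)) * (1 + Real.exp (-x ^ 2)) /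
        ((1 - Real.exp (-x ^ 2)) * ((1 - Real.exp (-x ^ 2)) ^ 2 +
          2 * Real.exp (-x ^ 2) * (1 - Real.cos (x ^ 3 * u)))) := by
  have hpi := Real.pi_pos
  have hcos := Real.cos_le_one_sub_mul_cos_sq hu
  have hr := Real.add_one_le_exp (-x ^ 2)
  have hx2 : 0 < x ^ 2 := by positivity
  have hr1 : Real.exp (-x ^ 2) < 1 := Real.exp_lt_one_iff.2 (by linarith)
  set r := Real.exp (-x ^ 2)
  set c := 1 - Real.cos (x ^ 3 * u)
  set b := 2 / Real.pi ^ 2 * (x ^ 3 * u) ^ 2 with hb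
  have hb0 : 0 ≤ b := by positivity
  have hcb : b ≤ c := by linarith
  have hc0 : 0 ≤ c := hb0.trans hcb
  have hr2 : 1 / 2 ≤ r := by linarith
  have hB : b ≤ 2 * r * c := by nlinarith
  have hB0 : 0 ≤ 2 * r * c := hb0.trans hB
  have hA : (1 - r) ^ 2 ≤ (x ^ 2) ^ 2 := by
    have : 0 ≤ 1 - r := by linarith
    gcongr
    linarith
  have hA0 : 0 < (1 - r) ^ 2 := by
    have : 0 < 1 - r := by linarith
    positivity
  -- B/(A + B) increases in B and decreases in A.
  have h1 : b / ((x ^ 2) ^ 2 + b) ≤ (2 * r * c) / ((1 - r) ^ 2 + 2 * r * c) := by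
    rw [div_le_div_iff₀ (by positivity) (by linarith)]
    nlinarith [mul_le_mul hB hA hA0.le hB0]
  have h2 : 1 / (2 * x ^ 2) ≤ (1 + r) / (2 * (1 - r)) := by
    rw [div_le_div_iff₀ (by positivity) (by linarith)]
    nlinarith
  have h3 : (1 / Real.pi ^ 2 * u ^ 2) / (1 + 2 / Real.pi ^ 2 * u ^ 2 * x ^ 2) =
      1 / (2 * x ^ 2) * (b / ((x ^ 2) ^ 2 + b)) := by
    have : 0 < 1 + 2 / Real.pi ^ 2 * u ^ 2 * x ^ 2 := by positivity
    have e : (x ^ 2) ^ 2 + b = x ^ 4 * (1 + 2 / Real.pi ^ 2 * u ^ 2 * x ^ 2) := by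
      rw [hb]; ring
    rw [e, hb]
    field_simp
  have h4 : r * c * (1 + r) / ((1 - r) * ((1 - r) ^ 2 + 2 * r * c)) =
      (1 + r) / (2 * (1 - r)) * ((2 * r * c) / ((1 - r) ^ 2 + 2 * r * c)) := by
    rw [div_mul_div_comm, mul_assoc 2 (1 - r), show (1 + r) * (2 * r * c) = 2 * (r * c * (1 + r)) by
      ring, mul_div_mul_left _ _ two_ne_zero]
  rw [h3, h4]
  exact mul_le_mul h2 h1 (by positivity) (div_nonneg (by linarith) (by linarith))

/-- If ux is small, the exponent is of order u². Otherwise it is at least of order 1/x², while |x³u|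
≤ π bounds 1 + u² by 11/x⁶, which the cubic Taylor term of the exponential absorbs. The constant is
generous. -/
theorem exp_neg_saddle_exponent_le {x u : ℝ} (hx : 0 < x) (hx1 : x ^ 2 ≤ 1 / 2)
    (hu : |x ^ 3 * u| ≤ Real.pi) :
    Real.exp (-(3 / 4 * ((1 / Real.pi ^ 2 * u ^ 2) / (1 + 2 / Real.pi ^ 2 * u ^ 2 * x ^ 2)))) ≤
      20000 * (1 + u ^ 2)⁻¹ := by
  have hpi := Real.pi_pos
  have hpi2 : Real.pi ^ 2 < 10 := by nlinarith [Real.pi_lt_d2]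
  have hx2 : 0 < x ^ 2 := by positivity
  set Y := (1 / Real.pi ^ 2 * u ^ 2) / (1 + 2 / Real.pi ^ 2 * u ^ 2 * x ^ 2) with hY
  have hden : 0 < 1 + 2 / Real.pi ^ 2 * u ^ 2 * x ^ 2 := by positivity
  have hinv : 1 / 10 ≤ 1 / Real.pi ^ 2 := by
    apply one_div_le_one_div_of_le <;> nlinarith
  rw [Real.exp_neg, ← div_eq_mul_inv, inv_eq_one_div,
    div_le_div_iff₀ (Real.exp_pos _) (by positivity), one_mul]
  rcases le_total (2 / Real.pi ^ 2 * u ^ 2 * x ^ 2) 1 with h | h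
  · have hYl : u ^ 2 / 20 ≤ Y := by
      rw [hY, le_div_iff₀ hden]
      have : u ^ 2 / 20 * (1 + 2 / Real.pi ^ 2 * u ^ 2 * x ^ 2) ≤ u ^ 2 / 20 * 2 := by gcongr; linarith
      nlinarith [mul_le_mul_of_nonneg_right hinv (sq_nonneg u)]
    have := Real.add_one_le_exp (3 / 4 * Y)
    nlinarith [sq_nonneg u]
  · have hYl : 1 / (4 * x ^ 2) ≤ Y := by
      rw [hY, div_le_div_iff₀ (by positivity) hden, one_mul]
      have : 1 / Real.pi ^ 2 * u ^ 2 * (4 * x ^ 2) = 2 * (2 / Real.pi ^ 2 * u ^ 2 * x ^ 2) := by ring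
      linarith
    have h0 : (0 : ℝ) ≤ 3 / 4 * (1 / (4 * x ^ 2)) := by positivity
    have h6 := Real.pow_div_factorial_le_exp (3 / 4 * (1 / (4 * x ^ 2))) h0 3
    have h7 : Real.exp (3 / 4 * (1 / (4 * x ^ 2))) ≤ Real.exp (3 / 4 * Y) := by gcongr
    have hux : u ^ 2 * (x ^ 2) ^ 3 ≤ 10 := by
      have := sq_le_sq.2 (hu.trans_eq (abs_of_pos hpi).symm)
      nlinarith
    have hxx : (x ^ 2) ^ 3 ≤ 1 := pow_le_one₀ hx2.le (by linarith)
    have h8 : 1 + u ^ 2 ≤ 11 / (x ^ 2) ^ 3 := by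
      rw [le_div_iff₀ (by positivity)]
      nlinarith
    have h9 : 11 / (x ^ 2) ^ 3 ≤
        20000 * ((3 / 4 * (1 / (4 * x ^ 2))) ^ 3 / (Nat.factorial 3 : ℝ)) := by
      have : (3 / 4 * (1 / (4 * x ^ 2))) ^ 3 / (Nat.factorial 3 : ℝ) =
          (27 / 24576) * (1 / (x ^ 2) ^ 3) := by
        rw [show (Nat.factorial 3 : ℝ) = 6 by norm_num [Nat.factorial]]
        field_simp
        norm_num
      rw [this, div_eq_mul_one_div]
      have : 0 < 1 / (x ^ 2) ^ 3 := by positivity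
      nlinarith
    linarith

open Complex in
-- Cubing the bound for the product gives exp(π²/(4x²)), exactly cancelled by the normalisation;
-- what remains is the decay in u times exp(x²/8) ≤ 2.
theorem norm_saddleIntegrand_le {x u : ℝ} (hx : 0 < x) (hx1 : x ^ 2 ≤ 1 / 2)
    (hu : |x ^ 3 * u| ≤ Real.pi) :
    ‖saddleIntegrand x u‖ ≤ 40000 * (1 + u ^ 2)⁻¹ := by
  have hx2 : 0 < x ^ 2 := by positivity
  have hr1 : Real.exp (-x ^ 2) < 1 := Real.exp_lt_one_iff.2 (by linarith)
  have e1 : exp (-((x : ℂ) ^ 2 - (x ^ 3 * u : ℝ) * I)) =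
      (Real.exp (-x ^ 2) : ℝ) * exp ((x ^ 3 * u : ℝ) * I) := by
    push_cast
    rw [← exp_add]
    ring_nf
  have e2 : (-((Real.pi : ℂ) ^ 2 / (4 * x ^ 2)) * (1 + u * x * I)).re =
      -(Real.pi ^ 2 / (4 * x ^ 2)) := by
    have : -((Real.pi : ℂ) ^ 2 / (4 * x ^ 2)) * (1 + u * x * I) =
        ((-(Real.pi ^ 2 / (4 * x ^ 2)) : ℝ) : ℂ) * (1 + (u * x : ℝ) * I) := by push_cast; ring
    rw [this, re_ofReal_mul]
    simp
  have h1 := norm_prodOneAddPow_le (Real.exp_pos (-x ^ 2)).le hr1 (x ^ 3 * u)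
  have h2 := le_geometric_cos_sum hx hx1 hu
  have h3 := norm_prodOneAddPow_exp_neg_le hx2
  have h4 := exp_neg_saddle_exponent_le hx hx1 hu
  set Y := (1 / Real.pi ^ 2 * u ^ 2) / (1 + 2 / Real.pi ^ 2 * u ^ 2 * x ^ 2)
  rw [saddleIntegrand, norm_mul, norm_mul, norm_pow, norm_pow, norm_exp, e1, e2, norm_real,
    Real.norm_of_nonneg (Real.sqrt_nonneg 2)]
  have h5 : √2 * ‖prodOneAddPow ((Real.exp (-x ^ 2) : ℝ) * exp ((x ^ 3 * u : ℝ) * I))‖ ≤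
      Real.exp (x ^ 2 / 24 + Real.pi ^ 2 / (12 * x ^ 2)) * Real.exp (-Y / 4) := by
    calc _ ≤ √2 * (‖prodOneAddPow (Real.exp (-x ^ 2) : ℝ)‖ * Real.exp (-Y / 4)) := by
          gcongr
          refine h1.trans ?_
          gcongr
      _ = (‖prodOneAddPow (Real.exp (-x ^ 2) : ℝ)‖ * √2) * Real.exp (-Y / 4) := by ring
      _ ≤ _ := by gcongr
  calc _ = (√2 * ‖prodOneAddPow ((Real.exp (-x ^ 2) : ℝ) * exp ((x ^ 3 * u : ℝ) * I))‖) ^ 3 *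
        Real.exp (-(Real.pi ^ 2 / (4 * x ^ 2))) := by ring
    _ ≤ (Real.exp (x ^ 2 / 24 + Real.pi ^ 2 / (12 * x ^ 2)) * Real.exp (-Y / 4)) ^ 3 *
        Real.exp (-(Real.pi ^ 2 / (4 * x ^ 2))) := by gcongr
    _ = Real.exp (x ^ 2 / 8) * Real.exp (-(3 / 4 * Y)) := by
        rw [← Real.exp_add, ← Real.exp_nat_mul, ← Real.exp_add, ← Real.exp_add]
        congr 1
        push_cast
        field_simp
        ring
    _ ≤ 2 * (20000 * (1 + u ^ 2)⁻¹) := by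
        gcongr
        rw [← Real.le_log_iff_exp_le two_pos]
        linarith [Real.log_two_gt_d9]
    _ = _ := by ring

open Complex Filter Topology in
theorem aestronglyMeasurable_saddleIntegrand {x : ℝ} (hx : 0 < x) :
    MeasureTheory.AEStronglyMeasurable (saddleIntegrand x) := by
  have hd : MeasureTheory.AEStronglyMeasurable
      (fun u : ℝ => prodOneAddPow (exp (-((x : ℂ) ^ 2 - (x ^ 3 * u : ℝ) * I)))) := by
    refine aestronglyMeasurable_of_tendsto_ae atTop
      (f := fun N (u : ℝ) => ∏ k ∈ Finset.range N,
        (1 + exp (-((x : ℂ) ^ 2 - (x ^ 3 * u : ℝ) * I)) ^ (k + 1)))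
      (fun N => Continuous.aestronglyMeasurable (by fun_prop))
      (MeasureTheory.ae_of_all _ fun u => tendsto_prod_prodOneAddPow (norm_exp_neg_lt_one ?_))
    rw [re_sq_sub_mul_I]
    positivity
  have he : MeasureTheory.AEStronglyMeasurable
      (fun u : ℝ => exp (-((Real.pi : ℂ) ^ 2 / (4 * x ^ 2)) * (1 + u * x * I))) :=
    Continuous.aestronglyMeasurable (by fun_prop)
  exact ((hd.pow 3).const_mul _).mul he

open Complex Filter Topology MeasureTheory in
theorem tendsto_integral_saddleIntegrand :
    Tendsto (fun x : ℝ => ∫ u in (-(Real.pi / x ^ 3))..(Real.pi / x ^ 3), saddleIntegrand x u)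
      (𝓝[>] 0) (𝓝 ((2 / √Real.pi : ℝ) : ℂ)) := by
  have hpi := Real.pi_pos
  have hval : ((2 / √Real.pi : ℝ) : ℂ) =
      ∫ u : ℝ, ((Real.exp (-(Real.pi ^ 2 / 4) * u ^ 2) : ℝ) : ℂ) := by
    rw [integral_complex_ofReal, integral_gaussian]
    congr 1
    rw [show Real.pi / (Real.pi ^ 2 / 4) = 2 ^ 2 / Real.pi by field_simp; norm_num, Real.sqrt_div (by norm_num),
      Real.sqrt_sq (by norm_num)]
  have hev : ∀ᶠ x : ℝ in 𝓝[>] 0, 0 < x ∧ x ^ 2 ≤ 1 / 2 := by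
    filter_upwards [Ioo_mem_nhdsGT (show (0 : ℝ) < 1 / 2 by norm_num)] with x hx
    exact ⟨hx.1, by nlinarith [hx.1, hx.2]⟩
  -- The indicator fixes the domain; each u eventually lies in the growing window.
  have key : Tendsto (fun x : ℝ => ∫ u, (Set.Ioc (-(Real.pi / x ^ 3)) (Real.pi / x ^ 3)).indicator
      (saddleIntegrand x) u) (𝓝[>] 0)
      (𝓝 (∫ u : ℝ, ((Real.exp (-(Real.pi ^ 2 / 4) * u ^ 2) : ℝ) : ℂ))) := by
    refine tendsto_integral_filter_of_dominated_convergence (fun u => 40000 * (1 + u ^ 2)⁻¹)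
      ?_ ?_ (integrable_inv_one_add_sq.const_mul _) ?_
    · filter_upwards [hev] with x hx
      exact (aestronglyMeasurable_saddleIntegrand hx.1).indicator measurableSet_Ioc
    · filter_upwards [hev] with x hx
      refine ae_of_all _ fun u => ?_
      by_cases hu : u ∈ Set.Ioc (-(Real.pi / x ^ 3)) (Real.pi / x ^ 3)
      · rw [Set.indicator_of_mem hu]
        refine norm_saddleIntegrand_le hx.1 hx.2 ?_
        have hx3 : 0 < x ^ 3 := pow_pos hx.1 3
        rw [abs_mul, abs_of_pos hx3, mul_comm, ← le_div_iff₀ hx3]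
        exact abs_le.2 ⟨hu.1.le, hu.2⟩
      · rw [Set.indicator_of_notMem hu, norm_zero]
        positivity
    · refine ae_of_all _ fun u => (tendsto_saddleIntegrand u).congr' ?_
      have h1 : Tendsto (fun x : ℝ => |u| * x ^ 3) (𝓝[>] 0) (𝓝 0) := by
        have : ContinuousAt (fun x : ℝ => |u| * x ^ 3) 0 := by fun_prop
        simpa using this.tendsto.mono_left (nhdsWithin_le_nhds (s := Set.Ioi 0))
      filter_upwards [hev, h1.eventually_lt_const hpi] with x hx hlt
      have hx3 : 0 < x ^ 3 := pow_pos hx.1 3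
      rw [Set.indicator_of_mem]
      rw [← lt_div_iff₀ hx3, abs_lt] at hlt
      exact ⟨hlt.1, hlt.2.le⟩
  rw [hval]
  refine key.congr' ?_
  filter_upwards [hev] with x hx
  have hx3 : 0 < x ^ 3 := pow_pos hx.1 3
  have : 0 < Real.pi / x ^ 3 := by positivity
  rw [integral_indicator measurableSet_Ioc, intervalIntegral.integral_of_le (by linarith)]

/-! ### Conclusion at the saddle point. -/

open Complex in
-- Substitute θ = x³u in the coefficient integral. The condition on n makes s = x² the critical
-- point of ns + π²/(4s), whose value there is π²/(2x²).
theorem sigmaMexOver_mul_eq_integral {n : ℕ} {x : ℝ} (hx : 0 < x)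
    (hn : (n : ℝ) = Real.pi ^ 2 / (4 * x ^ 4)) :
    (sigmaMexOver n : ℂ) * (2 * Real.pi * √2 ^ 3) =
      Real.exp (Real.pi ^ 2 / (2 * x ^ 2)) * x ^ 3 *
        ∫ u in (-(Real.pi / x ^ 3))..(Real.pi / x ^ 3), saddleIntegrand x u := by
  have hx3 : 0 < x ^ 3 := pow_pos hx 3
  have h := integral_prodOneAddPow_cube n (t := x ^ 2) (by positivity)
  have hsub := intervalIntegral.integral_comp_mul_left (a := -(Real.pi / x ^ 3))
    (b := Real.pi / x ^ 3) (fun θ : ℝ => prodOneAddPow (exp (-((x ^ 2 : ℝ) - θ * I))) ^ 3 *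
      exp (n * ((x ^ 2 : ℝ) - θ * I))) hx3.ne'
  rw [mul_neg, mul_div_cancel₀ _ hx3.ne', h] at hsub
  have hx0 : (x : ℂ) ≠ 0 := by exact_mod_cast hx.ne'
  have hnc : (n : ℂ) = Real.pi ^ 2 / (4 * x ^ 4) := by
    rw [← ofReal_natCast, hn]; push_cast; rfl
  have e : ∀ u : ℝ, saddleIntegrand x u * Real.exp (Real.pi ^ 2 / (2 * x ^ 2)) = √2 ^ 3 *
      (prodOneAddPow (exp (-((x ^ 2 : ℝ) - (x ^ 3 * u : ℝ) * I))) ^ 3 *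
        exp (n * ((x ^ 2 : ℝ) - (x ^ 3 * u : ℝ) * I))) := by
    intro u
    rw [saddleIntegrand, ofReal_exp, mul_assoc, ← exp_add, mul_assoc, hnc, ofReal_pow x 2]
    congr 3
    push_cast
    field_simp
    ring
  have e2 := congrArg (fun f : ℝ → ℂ => ∫ u in (-(Real.pi / x ^ 3))..(Real.pi / x ^ 3), f u)
    (funext e)
  simp only [intervalIntegral.integral_mul_const, intervalIntegral.integral_const_mul] at e2
  rw [hsub, real_smul] at e2
  have hinv : (((x ^ 3)⁻¹ : ℝ) : ℂ) * x ^ 3 = 1 := by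
    rw [← ofReal_pow, ← ofReal_mul, inv_mul_cancel₀ hx3.ne', ofReal_one]
  linear_combination (-(x : ℂ) ^ 3) * e2 - (√2 ^ 3 * (2 * Real.pi * sigmaMexOver n)) * hinv

open Filter Topology in
theorem theorem2 :
    Asymptotics.IsEquivalent Filter.atTop
      (fun n : ℕ => (sigmaMexOver n : ℝ))
      (fun n : ℕ => Real.exp (Real.pi * Real.sqrt (n : ℝ)) / (8 * (n : ℝ) ^ ((3 : ℝ) / 4))) := by
  have hpi := Real.pi_pos
  -- The saddle x² = π/(2√n).
  set x : ℕ → ℝ := fun n => √(Real.pi / 2) / √√(n : ℝ) with hxdef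
  have hsq : Tendsto (fun n : ℕ => √√(n : ℝ)) atTop atTop :=
    Real.tendsto_sqrt_atTop.comp (Real.tendsto_sqrt_atTop.comp tendsto_natCast_atTop_atTop)
  have hx : Tendsto x atTop (𝓝[>] 0) := by
    refine tendsto_nhdsWithin_iff.2 ⟨hsq.const_div_atTop _, ?_⟩
    filter_upwards [hsq.eventually_gt_atTop 0] with n hn
    exact div_pos (Real.sqrt_pos.2 (by positivity)) hn
  have hlim := (tendsto_integral_saddleIntegrand.comp hx).mul_const
    ((√(Real.pi / 2) ^ 3 * 8 / (2 * Real.pi * √2 ^ 3) : ℝ) : ℂ)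
  -- The Gaussian integral times the constants of x³ = (π/2)^(3/2) n^(-3/4), the Cauchy factor and
  -- the target 1/8.
  have hone : (2 / √Real.pi) * (√(Real.pi / 2) ^ 3 * 8 / (2 * Real.pi * √2 ^ 3)) = 1 := by
    have h2 : √2 ^ 2 = (2 : ℝ) := Real.sq_sqrt (by norm_num)
    have hp : √Real.pi ^ 2 = Real.pi := Real.sq_sqrt hpi.le
    have h2p : (0 : ℝ) < √2 := Real.sqrt_pos.2 two_pos
    have hpp : 0 < √Real.pi := Real.sqrt_pos.2 hpi
    rw [Real.sqrt_div hpi.le]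
    nth_rw 3 [← hp]
    field_simp
    rw [show (√2 : ℝ) ^ 6 = (√2 ^ 2) ^ 3 by ring, h2]
    norm_num
  rw [← Complex.ofReal_mul, hone, Complex.ofReal_one] at hlim
  have hre := (Complex.continuous_re.tendsto _).comp hlim
  rw [Complex.one_re] at hre
  refine (Asymptotics.isEquivalent_iff_tendsto_one ?_).2 (hre.congr' ?_)
  · filter_upwards [eventually_gt_atTop 0] with n hn
    have : (0 : ℝ) < n := by exact_mod_cast hn
    positivity
  · filter_upwards [eventually_gt_atTop 0] with n hn
    have hn0 : (0 : ℝ) < n := by exact_mod_cast hn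
    set y := √√(n : ℝ) with hy
    have hy0 : 0 < y := Real.sqrt_pos.2 (Real.sqrt_pos.2 hn0)
    have hy2 : y ^ 2 = √(n : ℝ) := Real.sq_sqrt (Real.sqrt_nonneg _)
    have hy4 : y ^ 4 = n := by
      rw [show y ^ 4 = (y ^ 2) ^ 2 by ring, hy2, Real.sq_sqrt hn0.le]
    have hy3 : (n : ℝ) ^ ((3 : ℝ) / 4) = y ^ 3 := by
      rw [← hy4, ← Real.rpow_natCast y 4, ← Real.rpow_mul hy0.le, ← Real.rpow_natCast y 3]
      norm_num
    set c := √(Real.pi / 2) with hc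
    have hc0 : 0 < c := Real.sqrt_pos.2 (by positivity)
    have hc2 : c ^ 2 = Real.pi / 2 := Real.sq_sqrt (by positivity)
    have hxn : x n = c / y := rfl
    have hx0 : 0 < x n := by rw [hxn]; positivity
    have hx2 : (x n) ^ 2 = Real.pi / 2 / √(n : ℝ) := by rw [hxn, div_pow, hc2, hy2]
    have hsn : 0 < √(n : ℝ) := Real.sqrt_pos.2 hn0
    have hnx : (n : ℝ) = Real.pi ^ 2 / (4 * (x n) ^ 4) := by
      rw [show (x n) ^ 4 = ((x n) ^ 2) ^ 2 by ring, hx2, div_pow, Real.sq_sqrt hn0.le]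
      field_simp
      norm_num
    have key := sigmaMexOver_mul_eq_integral hx0 hnx
    have hexp : Real.pi ^ 2 / (2 * (x n) ^ 2) = Real.pi * √(n : ℝ) := by
      rw [hx2]; field_simp
    rw [hexp] at key
    simp only [Function.comp_apply, Pi.div_apply]
    set J := ∫ u in (-(Real.pi / (x n) ^ 3))..(Real.pi / (x n) ^ 3), saddleIntegrand (x n) u
    have key2 := congrArg Complex.re key
    rw [show (sigmaMexOver n : ℂ) * (2 * Real.pi * √2 ^ 3) =
      (((sigmaMexOver n : ℝ) * (2 * Real.pi * √2 ^ 3) : ℝ) : ℂ) by push_cast; ring,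
      ← Complex.ofReal_pow, ← Complex.ofReal_mul, Complex.ofReal_re, Complex.re_ofReal_mul] at key2
    rw [Complex.re_mul_ofReal, hy3]
    have h2p : (0 : ℝ) < √2 := Real.sqrt_pos.2 two_pos
    have hσ : (sigmaMexOver n : ℝ) =
        Real.exp (Real.pi * √(n : ℝ)) * (c / y) ^ 3 * J.re / (2 * Real.pi * √2 ^ 3) := by
      rw [eq_div_iff (by positivity), key2, hxn]
    rw [hσ]
    have := Real.exp_pos (Real.pi * √(n : ℝ))
    field_simp
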